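/- Let $n\ge 1$. A proper cone in a finite-dimensional real vector space $V$ is a set $K\subseteq V$ that is closed under addition and under multiplication by nonnegative reals, satisfies $K\cap(-K)=\{0\}$, is closed, and has nonempty interior. A linear operator $T:V\to V$ is primitive with respect to $K$ if $T\neq 0$, $TK\subseteq K$, and the only nonempty subset $S\subseteq\partial K$ with $TS\subseteq S$ is $S=\{0\}$. (If $\dim V\ge 2$, the condition $T\ne0$ follows from the other ones; if $\dim V=1$, primitivity means that $T$ is multiplication by a positive number.) A linear operator $A:\mathbb R^n\to\mathbb R^n$ is generalized oscillatory if $A$ is primitive with respect to some proper cone $K_1\subset\mathbb R^n$ and, for every $j=2,\dots,n$, the exterior power $\wedge^jA$ is primitive with respect to some proper cone $K_j\subset\wedge^j\mathbb R^n=\mathbb R^{\binom nj}$. Theorem. Let $A:\mathbb R^n\to\mathbb R^n$ be generalized oscillatory. Then all the eigenvalues of $A$ (over $\mathbb C$, counted with algebraic multiplicity) are simple, positive and different in modulus from each other: they can be numbered $\lambda_1,\dots,\lambda_n$ so that $$\rho(A)=\lambda_1>\lambda_2>\dots>\lambda_n>0 .$$ Moreover, $\lambda_j=\rho(\wedge^jA)/\rho(\wedge^{j-1}A)$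 for $j=1,\dots,n$. Here $\rho$ is the spectral radius (the largest modulus of a complex eigenvalue), $\wedge^1A=A$, and $\wedge^0A$ is the identity of $\mathbb R$. -/

import Mathlib

open scoped TensorProduct

noncomputable section

/-- A proper cone: a convex cone that is pointed (`K ∩ (-K) = {0}`), closed and solid
(nonempty interior). -/
structure IsProperCone {V : Type*} [AddCommGroup V] [Module ℝ V] [TopologicalSpace V]
    (K : Set V) : Prop where
  add_mem : ∀ x ∈ K, ∀ y ∈ K, x + y ∈ K
  smul_mem : ∀ a : ℝ, 0 ≤ a → ∀ x ∈ K, a • x ∈ K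
  pointed : K ∩ {x | -x ∈ K} = {0}
  closed : IsClosed K
  solid : (interior K).Nonempty

/-- `T` is primitive with respect to the proper cone `K`: `T K ⊆ K`, and the only nonempty subset
of the boundary of `K` that `T` leaves invariant is `{0}`.  The requirement `T ≠ 0` matters only
on a one-dimensional space, where the boundary of `K` is `{0}` and the boundary condition is void;
in dimension at least two it follows from the boundary condition. -/
structure IsConePrimitive {V : Type*} [AddCommGroup V] [Module ℝ V] [TopologicalSpace V]
    (K : Set V) (T : V →ₗ[ℝ] V) : Prop where
  mapsTo : Set.MapsTo T K K
  boundary : ∀ S : Set V, S ⊆ frontier K → S.Nonempty → Set.MapsTo T S S → S = {0}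
  ne_zero : T ≠ 0

/-- `A` is generalized oscillatory: `A` is primitive with respect to a proper cone of `ℝⁿ`, and for
`2 ≤ j ≤ n` its `j`-th exterior power is primitive with respect to a proper cone of `⋀ʲ ℝⁿ`. -/
def IsGeneralizedOscillatory {n : ℕ}
    (A : EuclideanSpace ℝ (Fin n) →ₗ[ℝ] EuclideanSpace ℝ (Fin n)) : Prop :=
  (∃ K : Set (EuclideanSpace ℝ (Fin n)), IsProperCone K ∧ IsConePrimitive K A) ∧
  ∀ j : ℕ, 2 ≤ j → j ≤ n →
    ∃ K : Set (⋀[ℝ]^j (EuclideanSpace ℝ (Fin n))),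
      IsProperCone K ∧ IsConePrimitive K (exteriorPower.map j A)

/-- The (complex) eigenvalues of a real operator, repeated according to algebraic multiplicity. -/
def complexEigenvalues {V : Type*} [AddCommGroup V] [Module ℝ V] [FiniteDimensional ℝ V]
    (T : V →ₗ[ℝ] V) : Multiset ℂ :=
  (T.charpoly.map (algebraMap ℝ ℂ)).roots

/-- The spectral radius of an operator on a finite-dimensional real space: that of its
complexification. -/
def realSpectralRadius {V : Type*} [AddCommGroup V] [Module ℝ V] [FiniteDimensional ℝ V]
    (T : V →ₗ[ℝ] V) : ℝ :=
  (spectralRadius ℂ (T.baseChange ℂ : Module.End ℂ (ℂ ⊗[ℝ] V))).toReal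

end

/-! A cone-primitive operator satisfies Perron–Frobenius: its spectral radius is a simple positive
eigenvalue that strictly dominates all others (`IsConePrimitive.exists_isDominantEigenvalue`). The
existence of an interior eigenvector is a compactness argument. The rest is geometric: scale so that
$Tu=u$ with $u$ interior. If $T$ does not contract a family $u+\psi(F)$ avoiding 0, the largest ball
of it inside $K$ could be enlarged, so $K$ contains all of $u+\psi(F)$, and pointedness forces
$\psi=0$ (`eq_zero_of_intertwines`).

The eigenvalues of $\wedge^jA$ are the $j$-fold products of eigenvalues of $A$. Order these as
$|\lambda_1|\ge\dots\ge|\lambda_n|$. The product $\lambda_1\cdots\lambda_j$ has maximal modulus, so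
dominance gives $\lambda_1\cdots\lambda_j=\rho(\wedge^jA)>0$; quotients give the formula and
positivity. Equality $\lambda_i=\lambda_k$ with $i<k$ would make $\rho(\wedge^iA)$ a multiple
eigenvalue. -/

open scoped TensorProduct
open Set Topology Filter

/-! ### Perron–Frobenius geometry of proper cones -/

section Cone

variable {V : Type*} [NormedAddCommGroup V] [NormedSpace ℝ V] {K : Set V}

namespace IsProperCone

theorem zero_mem (hK : IsProperCone K) : (0 : V) ∈ K := by
  have : (0 : V) ∈ K ∩ {x | -x ∈ K} := by rw [hK.pointed]; rfl
  exact this.1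

theorem eq_zero_of_mem_of_neg_mem (hK : IsProperCone K) {x : V} (hx : x ∈ K) (hx' : -x ∈ K) :
    x = 0 := by
  have : x ∈ K ∩ {x | -x ∈ K} := ⟨hx, hx'⟩
  rwa [hK.pointed] at this

theorem add_mem_interior (hK : IsProperCone K) {x y : V} (hx : x ∈ interior K) (hy : y ∈ K) :
    x + y ∈ interior K := by
  have ho : IsOpen ((fun z => z + y) '' interior K) :=
    (Homeomorph.addRight y).isOpenMap _ isOpen_interior
  refine interior_maximal ?_ ho ⟨x, hx, rfl⟩
  rintro _ ⟨z, hz, rfl⟩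
  exact hK.add_mem _ (interior_subset hz) _ hy

theorem smul_mem_interior (hK : IsProperCone K) {x : V} {a : ℝ} (ha : 0 < a)
    (hx : x ∈ interior K) : a • x ∈ interior K := by
  have ho : IsOpen ((fun z => a • z) '' interior K) :=
    isOpenMap_smul₀ ha.ne' _ isOpen_interior
  refine interior_maximal ?_ ho ⟨x, hx, rfl⟩
  rintro _ ⟨z, hz, rfl⟩
  exact hK.smul_mem _ ha.le _ (interior_subset hz)

theorem exists_sub_smul_mem_interior {x : V} (hx : x ∈ interior K) (v : V) {d : ℝ} (hd : 0 < d) :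
    ∃ e : ℝ, 0 < e ∧ e < d ∧ x - e • v ∈ interior K := by
  have hc : Tendsto (fun e : ℝ => x - e • v) (𝓝[>] 0) (𝓝 x) := by
    have : Continuous (fun e : ℝ => x - e • v) := by fun_prop
    simpa using (this.tendsto 0).mono_left nhdsWithin_le_nhds
  have h1 := hc.eventually (isOpen_interior.mem_nhds hx)
  have h2 : ∀ᶠ e : ℝ in 𝓝[>] 0, e ∈ Ioo 0 d := Ioo_mem_nhdsGT hd
  obtain ⟨e, h, h'⟩ := (h1.and h2).exists
  exact ⟨e, h'.1, h'.2, h⟩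

theorem zero_notMem_interior [Nontrivial V] (hK : IsProperCone K) : (0 : V) ∉ interior K := by
  intro h0
  have hall : ∀ v : V, v ∈ K := by
    intro v
    obtain ⟨e, he, -, h⟩ := exists_sub_smul_mem_interior h0 (-v) one_pos
    have := hK.smul_mem e⁻¹ (by positivity) _ (interior_subset h)
    simpa [smul_smul, he.ne'] using this
  obtain ⟨v, hv⟩ := exists_ne (0 : V)
  exact hv (hK.eq_zero_of_mem_of_neg_mem (hall v) (hall _))

theorem ne_zero_of_mem_interior [Nontrivial V] (hK : IsProperCone K) {x : V}
    (hx : x ∈ interior K) : x ≠ 0 := by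
  rintro rfl
  exact hK.zero_notMem_interior hx

theorem mem_of_forall_add_nat_smul_mem (hK : IsProperCone K) {a b : V}
    (h : ∀ k : ℕ, a + (k : ℝ) • b ∈ K) : b ∈ K := by
  have ht : Tendsto (fun k : ℕ => ((k : ℝ) + 1)⁻¹ • a + b - ((k : ℝ) + 1)⁻¹ • (0 : V))
      atTop (𝓝 ((0 : ℝ) • a + b - (0 : ℝ) • (0 : V))) := by
    have h0 : Tendsto (fun k : ℕ => ((k : ℝ) + 1)⁻¹) atTop (𝓝 0) := by
      simpa using tendsto_one_div_add_atTop_nhds_zero_nat (𝕜 := ℝ)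
    exact ((h0.smul_const a).add_const b).sub (h0.smul_const _)
  simp only [smul_zero, sub_zero, zero_smul, zero_add] at ht
  refine hK.closed.mem_of_tendsto ht (Eventually.of_forall fun k => ?_)
  have hk : (0 : ℝ) < (k : ℝ) + 1 := by positivity
  have := hK.smul_mem ((k : ℝ) + 1)⁻¹ (by positivity) _ (h (k + 1))
  simpa [smul_add, smul_smul, hk.ne'] using this

end IsProperCone

namespace IsConePrimitive

variable {T : V →ₗ[ℝ] V}

theorem pow_mem (hT : IsConePrimitive K T) (k : ℕ) {x : V} (hx : x ∈ K) : (T ^ k) x ∈ K := by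
  induction k with
  | zero => simpa using hx
  | succ k ih => rw [pow_succ']; exact hT.mapsTo ih

theorem nontrivial (hT : IsConePrimitive K T) : Nontrivial V := by
  by_contra h
  rw [not_nontrivial_iff_subsingleton] at h
  exact hT.ne_zero (Subsingleton.elim _ _)

/-- If $Tx$ were on the boundary for one interior $x$, then $T$ would send all of $K$ to the
boundary, because $x-ey\in K$ for each $y$ and small $e>0$. The boundary would then be invariant,
hence $\{0\}$, and $T$ would vanish on a solid set. -/
theorem map_mem_interior (hT : IsConePrimitive K T) (hK : IsProperCone K) {x : V}
    (hx : x ∈ interior K) : T x ∈ interior K := by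
  have := hT.nontrivial
  by_contra hTx
  have key : ∀ y ∈ K, T y ∈ frontier K := by
    intro y hy
    rw [hK.closed.frontier_eq]
    refine ⟨hT.mapsTo hy, fun hTy => hTx ?_⟩
    obtain ⟨e, he, -, h⟩ := IsProperCone.exists_sub_smul_mem_interior hx y one_pos
    have := hK.add_mem_interior (hK.smul_mem_interior he hTy) (hT.mapsTo (interior_subset h))
    simpa using this
  have h0 : (0 : V) ∈ frontier K := by
    rw [hK.closed.frontier_eq]
    exact ⟨hK.zero_mem, hK.zero_notMem_interior⟩
  have hS := hT.boundary (frontier K) subset_rfl ⟨0, h0⟩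
    (fun y hy => key y (hK.closed.frontier_subset hy))
  have hz : ∀ y ∈ K, T y = 0 := fun y hy => by
    have := key y hy
    rwa [hS] at this
  refine hT.ne_zero (LinearMap.ext fun v => ?_)
  obtain ⟨e, he, -, h⟩ := IsProperCone.exists_sub_smul_mem_interior hx v one_pos
  have h1 := hz _ (interior_subset h)
  rw [map_sub, hz _ (interior_subset hx), map_smul, zero_sub, neg_eq_zero] at h1
  simpa [he.ne'] using h1

/-- Otherwise the forward orbit of $x$ is an invariant subset of the boundary other than $\{0\}$. -/
theorem exists_pow_mem_interior (hT : IsConePrimitive K T) (hK : IsProperCone K) {x : V}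
    (hx : x ∈ K) (hx0 : x ≠ 0) : ∃ k : ℕ, (T ^ k) x ∈ interior K := by
  by_contra! h
  have hS := hT.boundary (range fun k : ℕ => (T ^ k) x) ?_ ⟨x, 0, by simp⟩ ?_
  · have : x ∈ range fun k : ℕ => (T ^ k) x := ⟨0, by simp⟩
    rw [hS] at this
    exact hx0 this
  · rintro _ ⟨k, rfl⟩
    rw [hK.closed.frontier_eq]
    exact ⟨hT.pow_mem k hx, h k⟩
  · rintro _ ⟨k, rfl⟩
    exact ⟨k + 1, by simp [pow_succ']⟩

variable [FiniteDimensional ℝ V]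

/-- Some power of a primitive operator maps the nonzero part of the cone into its interior. -/
theorem exists_pow_forall_mem_interior (hT : IsConePrimitive K T) (hK : IsProperCone K) :
    ∃ m : ℕ, ∀ x ∈ K, x ≠ 0 → (T ^ m) x ∈ interior K := by
  have := FiniteDimensional.proper ℝ V
  have hC : IsCompact (K ∩ Metric.sphere (0 : V) 1) := (isCompact_sphere _ _).inter_left hK.closed
  obtain ⟨m, hm⟩ := hC.elim_directed_cover (fun k : ℕ => (T ^ k) ⁻¹' interior K)
    (fun k => isOpen_interior.preimage (LinearMap.continuous_of_finiteDimensional _))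
    (fun x hx => by
      have hx0 : x ≠ 0 := by rintro rfl; simpa using hx.2
      simpa using hT.exists_pow_mem_interior hK hx.1 hx0)
    (by
      refine (monotone_nat_of_le_succ fun k x hx => ?_).directed_le
      simp only [mem_preimage] at hx ⊢
      rw [pow_succ']
      exact hT.map_mem_interior hK hx)
  refine ⟨m, fun x hx hx0 => ?_⟩
  have hn : 0 < ‖x‖ := norm_pos_iff.2 hx0
  have hmem : ‖x‖⁻¹ • x ∈ K ∩ Metric.sphere (0 : V) 1 :=
    ⟨hK.smul_mem _ (by positivity) _ hx, by simp [norm_smul, hn.ne']⟩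
  have h1 := hK.smul_mem_interior hn (hm hmem)
  simpa [smul_smul, hn.ne'] using h1

/-- A primitive operator has an eigenvector in the interior of the cone, with positive eigenvalue. -/
theorem exists_eigenvector (hT : IsConePrimitive K T) (hK : IsProperCone K) :
    ∃ r : ℝ, 0 < r ∧ ∃ u ∈ interior K, T u = r • u := by
  have := hT.nontrivial
  have := FiniteDimensional.proper ℝ V
  have hTc : Continuous T := LinearMap.continuous_of_finiteDimensional _
  obtain ⟨m, hm⟩ := hT.exists_pow_forall_mem_interior hK
  obtain ⟨x₀, hx₀⟩ := hK.solid
  obtain ⟨e, he, -, hex⟩ := IsProperCone.exists_sub_smul_mem_interior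
    (hT.map_mem_interior hK hx₀) x₀ one_pos
  -- Collatz–Wielandt argument: minimise $s$ over pairs with $sTx-x\in K$. Homogeneity in $x$ allows
  -- restriction to unit vectors, and $s\le e^{-1}$ loses nothing since `x₀` is feasible there.
  have normalize : ∀ s : ℝ, 0 ≤ s → s ≤ e⁻¹ → ∀ x ∈ K, x ≠ 0 → s • T x - x ∈ K →
      (s, ‖x‖⁻¹ • x) ∈ (Icc 0 e⁻¹ ×ˢ (K ∩ Metric.sphere (0 : V) 1)) ∩
        {p : ℝ × V | p.1 • T p.2 - p.2 ∈ K} := by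
    intro s hs hs' x hx hx0 h
    have hn : 0 < ‖x‖ := norm_pos_iff.2 hx0
    refine ⟨⟨⟨hs, hs'⟩, hK.smul_mem _ (by positivity) _ hx, by simp [norm_smul, hn.ne']⟩, ?_⟩
    have := hK.smul_mem ‖x‖⁻¹ (by positivity) _ h
    rw [smul_sub, smul_comm] at this
    simpa using this
  have hQc : IsCompact ((Icc 0 e⁻¹ ×ˢ (K ∩ Metric.sphere (0 : V) 1)) ∩
      {p : ℝ × V | p.1 • T p.2 - p.2 ∈ K}) := by
    refine (isCompact_Icc.prod ((isCompact_sphere _ _).inter_left hK.closed)).inter_right ?_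
    exact hK.closed.preimage (f := fun p : ℝ × V => p.1 • T p.2 - p.2) (by fun_prop)
  have hQne := normalize e⁻¹ (by positivity) le_rfl x₀ (interior_subset hx₀)
    (hK.ne_zero_of_mem_interior hx₀) (by
      have := hK.smul_mem e⁻¹ (by positivity) _ (interior_subset hex)
      simpa [smul_sub, smul_smul, he.ne'] using this)
  obtain ⟨⟨s, x⟩, hmem, hmin⟩ := hQc.exists_isMinOn ⟨_, hQne⟩ continuous_fst.continuousOn
  obtain ⟨⟨⟨hs0, hse⟩, hxK, hx1⟩, hsx⟩ := hmem
  simp only [mem_ofPred_eq] at hs0 hse hxK hx1 hsx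
  have hx0 : x ≠ 0 := by rintro rfl; simp at hx1
  have hs : 0 < s := by
    refine lt_of_le_of_ne hs0 ?_
    rintro rfl
    exact hx0 (hK.eq_zero_of_mem_of_neg_mem hxK (by simpa using hsx))
  -- If the difference is nonzero, $T^m$ moves it into the interior; then $T^mx$ is feasible with a
  -- smaller $s$.
  have heq : s • T x - x = 0 := by
    by_contra hne
    have hw := hm _ hsx hne
    have hy := hm _ hxK hx0
    obtain ⟨d, hd, hds, hd'⟩ :=
      IsProperCone.exists_sub_smul_mem_interior hw (T ((T ^ m) x)) hs
    have hcomm : (T ^ m) (T x) = T ((T ^ m) x) := by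
      rw [← Module.End.mul_apply, ← Module.End.mul_apply, ← pow_succ, ← pow_succ']
    have hfeas := normalize (s - d) (by linarith) (by linarith) _ (interior_subset hy)
      (hK.ne_zero_of_mem_interior hy) (by
        have := interior_subset hd'
        rw [map_sub, map_smul, hcomm] at this
        convert this using 1
        module)
    have := hmin hfeas
    simp only [mem_ofPred_eq] at this
    linarith
  have hTx : T x = s⁻¹ • x := by
    rw [sub_eq_zero] at heq
    rw [← heq, smul_smul, inv_mul_cancel₀ hs.ne', one_smul, heq]
  refine ⟨s⁻¹, by positivity, x, ?_, hTx⟩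
  have hpow : ∀ k : ℕ, (T ^ k) x = (s⁻¹ ^ k) • x := by
    intro k
    induction k with
    | zero => simp
    | succ k ih => rw [pow_succ', Module.End.mul_apply, ih, map_smul, hTx, smul_smul, pow_succ]
  have h1 := hm x hxK hx0
  rw [hpow] at h1
  have h2 := hK.smul_mem_interior (a := (s⁻¹ ^ m)⁻¹) (by positivity) h1
  rwa [smul_smul, inv_mul_cancel₀ (by positivity), one_smul] at h2

end IsConePrimitive

namespace IsProperCone

variable {T : V →ₗ[ℝ] V} {m : ℕ} {u : V}

/-- An operator which fixes an interior vector and some power of which sends the nonzero part of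
the cone to its interior contracts every invariant affine family through that vector. -/
theorem eq_zero_of_intertwines (hK : IsProperCone K)
    (hm : ∀ x ∈ K, x ≠ 0 → (T ^ m) x ∈ interior K) (hu : u ∈ interior K) (hTu : T u = u)
    {F : Type*} [NormedAddCommGroup F] [NormedSpace ℝ F] [FiniteDimensional ℝ F]
    (ψ : F →ₗ[ℝ] V) (R : F → F) (hR : ∀ y, T (ψ y) = ψ (R y))
    (hsurj : ∀ y, ∃ x, R x = y ∧ ‖x‖ ≤ ‖y‖) (hne : ∀ y, u + ψ y ≠ 0) : ψ = 0 := by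
  have := FiniteDimensional.proper ℝ F
  have hψ : Continuous ψ := LinearMap.continuous_of_finiteDimensional _
  have hf : Continuous fun y => u + ψ y := by fun_prop
  have hpow : ∀ (k : ℕ) (y : F), ∃ x, (T ^ k) (u + ψ x) = u + ψ y ∧ ‖x‖ ≤ ‖y‖ := by
    intro k
    induction k with
    | zero => exact fun y => ⟨y, by simp⟩
    | succ k ih =>
      intro y
      obtain ⟨z, rfl, hz⟩ := hsurj y
      obtain ⟨x, hx, hxz⟩ := ih z
      refine ⟨x, ?_, hxz.trans hz⟩
      rw [pow_succ', Module.End.mul_apply, hx, map_add, hTu, hR]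
  rcases ((fun y => u + ψ y) ⁻¹' interior K)ᶜ.eq_empty_or_nonempty with hZ | hZ
  · have hall : ∀ y, u + ψ y ∈ K := fun y => by
      have : y ∈ (fun y => u + ψ y) ⁻¹' interior K := by
        rw [compl_empty_iff.1 hZ]; trivial
      exact interior_subset this
    have hmem : ∀ y, ψ y ∈ K := fun y =>
      hK.mem_of_forall_add_nat_smul_mem (a := u) fun k => by
        rw [← map_smul]; exact hall _
    ext y
    exact hK.eq_zero_of_mem_of_neg_mem (hmem y) (by rw [← map_neg]; exact hmem _)
  -- Take the parameter $y$ nearest to 0 whose point is not interior. The closed ball of radius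
  -- $\|y\|$ still maps into $K$ and contains an $m$-step preimage of $y$, so $T^m$ puts $u+\psi y$
  -- in the interior after all.
  · have hZc : IsClosed ((fun y => u + ψ y) ⁻¹' interior K)ᶜ :=
      (isOpen_interior.preimage hf).isClosed_compl
    obtain ⟨y, hy, hdist⟩ := hZc.exists_infDist_eq_dist hZ 0
    rw [dist_zero_left] at hdist
    exfalso
    apply hy
    have hy0 : ‖y‖ ≠ 0 := by
      rw [norm_ne_zero_iff]
      rintro rfl
      exact hy (by simpa using hu)
    have hball : Metric.closedBall (0 : F) ‖y‖ ⊆ (fun y => u + ψ y) ⁻¹' K := by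
      rw [← closure_ball _ hy0]
      refine closure_minimal (fun z hz => ?_) (hK.closed.preimage hf)
      by_contra hzK
      have hzZ : z ∈ ((fun y => u + ψ y) ⁻¹' interior K)ᶜ := fun h =>
        hzK (interior_subset (s := K) h)
      have := Metric.infDist_le_dist_of_mem (x := (0 : F)) hzZ
      rw [hdist, dist_zero_left] at this
      rw [mem_ball_zero_iff] at hz
      linarith
    obtain ⟨x, hx, hxy⟩ := hpow m y
    have hxK : u + ψ x ∈ K := hball (by simpa using hxy)
    change u + ψ y ∈ interior K
    rw [← hx]
    exact hm _ hxK (hne x)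

theorem mem_span_of_map_eq_self [Nontrivial V] (hK : IsProperCone K)
    (hm : ∀ x ∈ K, x ≠ 0 → (T ^ m) x ∈ interior K) (hu : u ∈ interior K) (hTu : T u = u)
    {v : V} (hv : T v = v) : v ∈ Submodule.span ℝ {u} := by
  by_contra hvu
  have hψ := hK.eq_zero_of_intertwines hm hu hTu (LinearMap.toSpanSingleton ℝ V v) id
    (by simp [hv]) (fun y => ⟨y, rfl, le_rfl⟩) (fun y h => by
      rw [LinearMap.toSpanSingleton_apply] at h
      have hy : y ≠ 0 := by
        rintro rfl
        exact hK.ne_zero_of_mem_interior hu (by simpa using h)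
      refine hvu (Submodule.mem_span_singleton.2 ⟨-y⁻¹, ?_⟩)
      rw [eq_neg_of_add_eq_zero_left h, smul_neg, neg_smul, neg_neg, smul_smul,
        inv_mul_cancel₀ hy, one_smul])
  have : v = 0 := by simpa using LinearMap.congr_fun hψ 1
  exact hvu (this ▸ Submodule.zero_mem _)

/-- This excludes Jordan blocks. If $Tv=v+cu$ with $c>0$, the iterates of $u-ev\in K$ drift in the
direction $-u$, so $-u$ would lie in the closed cone. For $c<0$ replace $v$ by $-v$. -/
theorem map_eq_self_of_sub_one_sq_eq_zero [Nontrivial V] (hK : IsProperCone K)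
    (hTK : MapsTo T K K)
    (hm : ∀ x ∈ K, x ≠ 0 → (T ^ m) x ∈ interior K) (hu : u ∈ interior K) (hTu : T u = u)
    {v : V} (hv : T (T v - v) = T v - v) : T v = v := by
  obtain ⟨c, hc⟩ := Submodule.mem_span_singleton.1 (hK.mem_span_of_map_eq_self hm hu hTu hv)
  have key : ∀ (c : ℝ) (v : V), T v = v + c • u → ¬ 0 < c := by
    intro c v hv hc
    obtain ⟨e, he, -, h⟩ := exists_sub_smul_mem_interior hu v one_pos
    have hk : ∀ k : ℕ, (u - e • v) + (k : ℝ) • (-(e * c) • u) ∈ K := by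
      intro k
      induction k with
      | zero => simpa using interior_subset h
      | succ k ih =>
        have := hTK ih
        convert this using 1
        simp only [map_add, map_sub, map_smul, hTu, hv]
        push_cast
        module
    have h1 := hK.mem_of_forall_add_nat_smul_mem hk
    have h2 := hK.smul_mem (e * c) (by positivity) _ (interior_subset hu)
    have h3 := hK.eq_zero_of_mem_of_neg_mem h2 (by simpa using h1)
    have := hK.ne_zero_of_mem_interior hu
    simp [he.ne', hc.ne', this] at h3
  have hTv : T v = v + c • u := by rw [hc]; abel
  rcases lt_trichotomy c 0 with h | rfl | h
  · refine absurd (neg_pos.2 h) (key (-c) (-v) ?_)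
    rw [map_neg, hTv]
    module
  · simpa using hTv
  · exact absurd h (key c v hTv)

theorem eq_zero_of_complex_intertwines [Nontrivial V] (hK : IsProperCone K)
    (hm : ∀ x ∈ K, x ≠ 0 → (T ^ m) x ∈ interior K) (hu : u ∈ interior K) (hTu : T u = u)
    (ψ : ℂ →ₗ[ℝ] V) {z : ℂ} (hz : z ≠ 1) (hz1 : 1 ≤ ‖z‖) (hψ : ∀ y, T (ψ y) = ψ (z * y)) :
    ψ = 0 := by
  have hz0 : z ≠ 0 := by rintro rfl; simp at hz1; linarith
  refine hK.eq_zero_of_intertwines hm hu hTu ψ (fun y => z * y) hψ (fun y => ?_) (fun y h => ?_)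
  · refine ⟨z⁻¹ * y, by field_simp, ?_⟩
    rw [norm_mul, norm_inv]
    exact mul_le_of_le_one_left (norm_nonneg _) (inv_le_one_of_one_le₀ hz1)
  · have hy : ψ y = -u := (neg_eq_of_add_eq_zero_right h).symm
    have h1 : ψ (z * y) = ψ y := by rw [← hψ, hy, map_neg, hTu]
    have h2 : ψ (z * (z * y)) = ψ y := by rw [← hψ, h1, hψ, h1]
    have hz2 : Complex.normSq (z - 1) ≠ 0 := by
      rw [Ne, Complex.normSq_eq_zero, sub_eq_zero]; exact hz
    -- From $z^2-2\,\mathrm{Re}(z)\,z+|z|^2=0$. The real coefficients on the right sum to zero, so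
    -- $\psi$, which agrees on $y$, $zy$ and $z^2y$, kills the left side.
    have h3 : Complex.normSq (z - 1) • y
        = (2 * z.re) • (z * y) - (2 * z.re) • y - (z * (z * y)) + y := by
      apply Complex.ext <;> simp [Complex.normSq_apply] <;> ring
    have h4 : ψ (Complex.normSq (z - 1) • y) = 0 := by
      rw [h3]
      simp only [map_add, map_sub, map_smul, h1, h2]
      module
    rw [map_smul, smul_eq_zero, or_iff_right hz2, hy, neg_eq_zero] at h4
    exact hK.ne_zero_of_mem_interior hu h4

end IsProperCone

end Cone

/-! ### Complex eigenvalues and dominant eigenvalues of real operators -/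

section ComplexEigenvalues

variable {V : Type*} [AddCommGroup V] [Module ℝ V]

/-- The map is $w\mapsto\mathrm{Re}(wy)$. It lets real cone geometry treat real and non-real
eigenvalues alike. -/
theorem exists_intertwining_of_baseChange_eigenvector {T : V →ₗ[ℝ] V} {z : ℂ} {y : ℂ ⊗[ℝ] V}
    (hy : y ≠ 0) (hz : T.baseChange ℂ y = z • y) :
    ∃ ψ : ℂ →ₗ[ℝ] V, ψ ≠ 0 ∧ ∀ w, T (ψ w) = ψ (z * w) := by
  let re : ℂ ⊗[ℝ] V →ₗ[ℝ] V := TensorProduct.lid ℝ V ∘ₗ LinearMap.rTensor V Complex.reLm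
  have hre : ∀ (c : ℂ) (v : V), re (c ⊗ₜ v) = c.re • v := fun c v => by simp [re]
  have hT : ∀ x, T (re x) = re (T.baseChange ℂ x) := fun x => by
    induction x with
    | zero => simp
    | tmul c v => simp [hre]
    | add a b ha hb => simp only [map_add, ha, hb]
  -- A vector is recovered from the real parts of itself and of its multiple by $i$; hence $\psi=0$
  -- would force $y=0$.
  have hdecomp : ∀ x : ℂ ⊗[ℝ] V, x = 1 ⊗ₜ re x - Complex.I ⊗ₜ re (Complex.I • x) := fun x => by
    induction x with
    | zero => simp
    | tmul c v =>
      rw [TensorProduct.smul_tmul', hre, hre, ← TensorProduct.smul_tmul, ← TensorProduct.smul_tmul,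
        ← TensorProduct.sub_tmul]
      congr 1
      apply Complex.ext <;> simp
    | add a b ha hb =>
      rw [smul_add, map_add, map_add, TensorProduct.tmul_add, TensorProduct.tmul_add]
      nth_rewrite 1 [ha, hb]
      abel
  let ψ : ℂ →ₗ[ℝ] V := re ∘ₗ (LinearMap.toSpanSingleton ℂ _ y).restrictScalars ℝ
  have hψ : ∀ w, ψ w = re (w • y) := fun w => rfl
  refine ⟨ψ, fun h => hy ?_, fun w => ?_⟩
  · have h1 := LinearMap.congr_fun h 1
    have h2 := LinearMap.congr_fun h Complex.I
    rw [hψ, LinearMap.zero_apply] at h1 h2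
    rw [one_smul] at h1
    rw [hdecomp y, h1, h2]
    simp
  · rw [hψ, hψ, hT, map_smul, hz, smul_smul, mul_comm]

variable [FiniteDimensional ℝ V]

theorem complexEigenvalues_eq (T : V →ₗ[ℝ] V) :
    complexEigenvalues T = (T.baseChange ℂ).charpoly.roots := by
  rw [complexEigenvalues, LinearMap.charpoly_baseChange]

theorem mem_complexEigenvalues_iff {T : V →ₗ[ℝ] V} {z : ℂ} :
    z ∈ complexEigenvalues T ↔ Module.End.HasEigenvalue (T.baseChange ℂ) z := by
  rw [complexEigenvalues_eq, Module.End.hasEigenvalue_iff_isRoot_charpoly,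
    Polynomial.mem_roots (LinearMap.charpoly_monic _).ne_zero]

theorem realSpectralRadius_eq {T : V →ₗ[ℝ] V} {r : ℝ} (hr : 0 ≤ r)
    (hmem : (r : ℂ) ∈ complexEigenvalues T) (hle : ∀ z ∈ complexEigenvalues T, ‖z‖ ≤ r) :
    realSpectralRadius T = r := by
  have : spectralRadius ℂ (T.baseChange ℂ : Module.End ℂ (ℂ ⊗[ℝ] V)) = ENNReal.ofReal r := by
    refine le_antisymm (iSup₂_le fun z hz => ?_) ?_
    · rw [← Module.End.hasEigenvalue_iff_mem_spectrum, ← mem_complexEigenvalues_iff] at hz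
      rw [← enorm_eq_nnnorm, ← ofReal_norm]
      exact ENNReal.ofReal_le_ofReal (hle z hz)
    · rw [mem_complexEigenvalues_iff, Module.End.hasEigenvalue_iff_mem_spectrum] at hmem
      refine le_trans (le_of_eq ?_) (le_iSup₂ (r : ℂ) hmem)
      rw [← enorm_eq_nnnorm, ← ofReal_norm]
      simp [abs_of_nonneg hr]
  rw [realSpectralRadius, this, ENNReal.toReal_ofReal hr]

/-- `r` is a simple positive eigenvalue of `T`, strictly dominating all others in modulus. -/
structure IsDominantEigenvalue (T : V →ₗ[ℝ] V) (r : ℝ) : Prop where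
  pos : 0 < r
  count_eq_one : (complexEigenvalues T).count (r : ℂ) = 1
  norm_lt : ∀ z ∈ complexEigenvalues T, z ≠ r → ‖z‖ < r

namespace IsDominantEigenvalue

variable {T : V →ₗ[ℝ] V} {r : ℝ}

theorem mem (h : IsDominantEigenvalue T r) : (r : ℂ) ∈ complexEigenvalues T :=
  Multiset.count_pos.1 (by rw [h.count_eq_one]; exact one_pos)

theorem realSpectralRadius_eq (h : IsDominantEigenvalue T r) : realSpectralRadius T = r :=
  _root_.realSpectralRadius_eq h.pos.le h.mem fun z hz => by
    by_cases hzr : z = r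
    · simp [hzr, abs_of_pos h.pos]
    · exact (h.norm_lt z hz hzr).le

end IsDominantEigenvalue

end ComplexEigenvalues

/-- The Perron–Frobenius theorem for operators which are primitive with respect to a cone. -/
theorem IsConePrimitive.exists_isDominantEigenvalue {V : Type*} [NormedAddCommGroup V]
    [NormedSpace ℝ V] [FiniteDimensional ℝ V] {K : Set V} {T : V →ₗ[ℝ] V}
    (hT : IsConePrimitive K T) (hK : IsProperCone K) : ∃ r, IsDominantEigenvalue T r := by
  have := hT.nontrivial
  obtain ⟨r, hr, u, hu, hTu⟩ := hT.exists_eigenvector hK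
  obtain ⟨m, hm⟩ := hT.exists_pow_forall_mem_interior hK
  have hu0 := hK.ne_zero_of_mem_interior hu
  have hm' : ∀ x ∈ K, x ≠ 0 → ((r⁻¹ • T) ^ m) x ∈ interior K := fun x hx hx0 => by
    rw [smul_pow, LinearMap.smul_apply]
    exact hK.smul_mem_interior (by positivity) (hm x hx hx0)
  have hTu' : (r⁻¹ • T) u = u := by
    rw [LinearMap.smul_apply, hTu, smul_smul, inv_mul_cancel₀ hr.ne', one_smul]
  have hTK : MapsTo (r⁻¹ • T) K K := fun x hx =>
    hK.smul_mem _ (by positivity) _ (hT.mapsTo hx)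
  have hfix : ∀ v, (r⁻¹ • T) v = v ↔ T v = r • v := fun v => by
    rw [LinearMap.smul_apply, inv_smul_eq_iff₀ hr.ne']
  have hgen : Module.End.maxGenEigenspace T r = Submodule.span ℝ {u} := by
    refine le_antisymm (fun v hv => ?_) ?_
    · obtain ⟨k, hk⟩ := (Module.End.mem_maxGenEigenspace T r v).1 hv
      refine hK.mem_span_of_map_eq_self hm' hu hTu' ((hfix v).2 ?_)
      clear hv
      induction k generalizing v with
      | zero =>
        have : v = 0 := by simpa using hk
        simp [this]
      | succ k ih =>
        rw [pow_succ, Module.End.mul_apply] at hk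
        have h1 := ih _ hk
        rw [← hfix]
        refine hK.map_eq_self_of_sub_one_sq_eq_zero hTK hm' hu hTu' ?_
        rw [hfix]
        have h2 : (r⁻¹ • T) v - v = r⁻¹ • (T - r • (1 : Module.End ℝ V)) v := by
          simp [smul_sub, smul_smul, hr.ne']
        rw [h2, map_smul, h1, smul_comm]
    · rw [Submodule.span_singleton_le_iff_mem]
      refine (Module.End.mem_maxGenEigenspace T r u).2 ⟨1, ?_⟩
      simp [hTu]
  refine ⟨r, hr, ?_, fun z hz hzr => ?_⟩
  · have h := LinearMap.finrank_maxGenEigenspace_eq T r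
    rw [hgen, finrank_span_singleton hu0,
      Polynomial.eq_rootMultiplicity_map (algebraMap ℝ ℂ).injective] at h
    rw [complexEigenvalues, Polynomial.count_roots]
    exact h.symm
  · obtain ⟨y, hy⟩ := (mem_complexEigenvalues_iff.1 hz).exists_hasEigenvector
    obtain ⟨ψ, hψ0, hψ⟩ := exists_intertwining_of_baseChange_eigenvector hy.2 hy.apply_eq_smul
    by_contra! hle
    have hrc : (r : ℂ) ≠ 0 := by exact_mod_cast hr.ne'
    refine hψ0 (hK.eq_zero_of_complex_intertwines hm' hu hTu' ψ (z := (r : ℂ)⁻¹ * z) ?_ ?_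
      fun w => ?_)
    · intro h
      rw [inv_mul_eq_iff_eq_mul₀ hrc, mul_one] at h
      exact hzr h
    · rw [norm_mul, norm_inv, Complex.norm_real, Real.norm_of_nonneg hr.le]
      rwa [inv_mul_eq_div, le_div_iff₀ hr, one_mul]
    · rw [LinearMap.smul_apply, hψ, ← map_smul]
      congr 1
      rw [Complex.real_smul]
      push_cast
      ring

/-! ### Triangularisation with ordered diagonal -/

section Triangular

/-- Every endomorphism of a finite-dimensional complex space has a triangular basis in which the
diagonal entries are sorted by decreasing modulus. -/
theorem exists_basis_isUpperTriangular_antitone {n : ℕ} {V : Type*} [AddCommGroup V] [Module ℂ V]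
    [FiniteDimensional ℂ V] (hn : Module.finrank ℂ V = n) (f : V →ₗ[ℂ] V) :
    ∃ b : Module.Basis (Fin n) ℂ V, (LinearMap.toMatrix b b f).IsUpperTriangular ∧
      Antitone fun i => ‖LinearMap.toMatrix b b f i i‖ := by
  induction n generalizing V with
  | zero =>
    exact ⟨Module.finBasisOfFinrankEq ℂ V hn, fun i => i.elim0, fun i => i.elim0⟩
  | succ n ih =>
    have : Nontrivial V := Module.nontrivial_of_finrank_pos (R := ℂ) (by omega)
    obtain ⟨μ₀, hμ₀⟩ := Module.End.exists_eigenvalue f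
    have hfin : {μ | Module.End.HasEigenvalue f μ}.Finite := Module.End.finite_hasEigenvalue f
    -- The last diagonal entry is split off first, so it must have the smallest modulus. The
    -- functional `φ` below is a left eigenvector for it, with invariant kernel.
    obtain ⟨μ, hμ, hmin⟩ := Set.exists_min_image _ (fun z : ℂ => ‖z‖) hfin ⟨μ₀, hμ₀⟩
    have hμ : Module.End.HasEigenvalue f μ := hμ
    have hlt : LinearMap.range (f - μ • LinearMap.id) < ⊤ := by
      rw [lt_top_iff_ne_top]
      intro htop
      obtain ⟨v, hv⟩ := hμ.exists_hasEigenvector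
      have hinj := LinearMap.injective_iff_surjective.2 (LinearMap.range_eq_top.1 htop)
      refine hv.2 (hinj ?_)
      simp [hv.apply_eq_smul]
    obtain ⟨φ, hφ0, hφ⟩ := Submodule.exists_le_ker_of_lt_top _ hlt
    have hφf : ∀ x, φ (f x) = μ * φ x := fun x => by
      have h : φ ((f - μ • LinearMap.id : V →ₗ[ℂ] V) x) = 0 := hφ ⟨x, rfl⟩
      simpa [sub_eq_zero] using h
    obtain ⟨y₀, hy₀⟩ : ∃ y, φ y ≠ 0 := by
      by_contra! h
      exact hφ0 (LinearMap.ext h)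
    obtain ⟨y, hy⟩ : ∃ y, φ y = 1 := ⟨(φ y₀)⁻¹ • y₀, by simp [hy₀]⟩
    have hrank : Module.finrank ℂ (LinearMap.ker φ) = n := by
      have := Module.Dual.finrank_ker_add_one_of_ne_zero hφ0
      omega
    have hmaps : ∀ x ∈ LinearMap.ker φ, f x ∈ LinearMap.ker φ := fun x hx => by
      rw [LinearMap.mem_ker] at hx ⊢
      rw [hφf, hx, mul_zero]
    obtain ⟨b', htri, hanti⟩ := ih hrank (f.restrict hmaps)
    let b := Module.Basis.mkFinSnoc b' y
      (fun c x hx h => by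
        have := congrArg φ h
        rwa [map_add, map_smul, hy, LinearMap.mem_ker.1 hx, map_zero, add_zero, smul_eq_mul,
          mul_one] at this)
      (fun z => ⟨-φ z, by simp [hy]⟩)
    have hbc : ∀ i : Fin n, b i.castSucc = b' i := fun i => by simp [b]
    have hbl : b (Fin.last n) = y := by simp [b]
    have hlast : ∀ x, b.repr x (Fin.last n) = φ x := fun x => by
      have : b.coord (Fin.last n) = φ := by
        refine b.ext fun i => ?_
        induction i using Fin.lastCases with
        | last => rw [hbl, hy, ← hbl]; simp
        | cast i =>
          have h1 : φ (b' i) = 0 := (b' i).2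
          have h2 : Fin.castSucc i ≠ Fin.last n := (Fin.castSucc_lt_last i).ne
          rw [hbc, h1, ← hbc]
          simp [h2]
      rw [← this]; rfl
    have hcast : ∀ (x : LinearMap.ker φ) (k : Fin n), b.repr (x : V) k.castSucc = b'.repr x k := by
      intro x k
      have : b.coord k.castSucc ∘ₗ (LinearMap.ker φ).subtype = b'.coord k := by
        refine b'.ext fun i => ?_
        simp [← hbc, Finsupp.single_apply]
      exact LinearMap.congr_fun this x
    have hM : ∀ i k : Fin n, LinearMap.toMatrix b b f i.castSucc k.castSucc
        = LinearMap.toMatrix b' b' (f.restrict hmaps) i k := fun i k => by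
      rw [LinearMap.toMatrix_apply, LinearMap.toMatrix_apply, ← hcast, hbc]
      rfl
    refine ⟨b, fun i k hik => ?_, fun i k hik => ?_⟩
    · induction k using Fin.lastCases with
      | last => exact absurd hik (Fin.le_last i).not_gt
      | cast k =>
        induction i using Fin.lastCases with
        | last =>
          rw [LinearMap.toMatrix_apply, hlast, hφf, hbc]
          have h1 : φ (b' k) = 0 := (b' k).2
          rw [h1, mul_zero]
        | cast i =>
          rw [hM]
          exact htri (by simpa using hik)
    · have hll : LinearMap.toMatrix b b f (Fin.last n) (Fin.last n) = μ := by
        rw [LinearMap.toMatrix_apply, hlast, hφf, hbl, hy, mul_one]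
      induction k using Fin.lastCases with
      | last =>
        induction i using Fin.lastCases with
        | last => exact le_rfl
        | cast i =>
          simp only [hll, hM]
          apply hmin
          have hroot : (f.restrict hmaps).charpoly.IsRoot
              (LinearMap.toMatrix b' b' (f.restrict hmaps) i i) := by
            rw [← LinearMap.charpoly_toMatrix _ b', Matrix.charpoly_of_isUpperTriangular _ htri,
              Polynomial.IsRoot.def, Polynomial.eval_prod]
            exact Finset.prod_eq_zero (Finset.mem_univ i) (by simp)
          obtain ⟨v, hv⟩ :=
            ((Module.End.hasEigenvalue_iff_isRoot_charpoly _ _).2 hroot).exists_hasEigenvector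
          refine Module.End.hasEigenvalue_of_hasEigenvector (x := (v : V))
            ⟨Module.End.mem_eigenspace_iff.2 ?_, by simpa using hv.2⟩
          exact congrArg Subtype.val hv.apply_eq_smul
      | cast k =>
        induction i using Fin.lastCases with
        | last => exact absurd hik (Fin.castSucc_lt_last k).not_ge
        | cast i =>
          simp only [hM]
          exact hanti (by simpa using hik)

end Triangular

/-! ### Compound matrices and their characteristic polynomials -/

namespace Matrix

variable {R : Type*} [CommRing R] {n j : ℕ}

/-- If the nonzero off-diagonal entries of a matrix strictly increase some weight, its
characteristic polynomial is that of its diagonal. -/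
theorem charpoly_of_weight_lt {ι : Type*} [Fintype ι] [DecidableEq ι] {M : Matrix ι ι R}
    (w : ι → ℕ) (h : ∀ i k, M i k ≠ 0 → i ≠ k → w i < w k) :
    M.charpoly = ∏ i, (Polynomial.X - Polynomial.C (M i i)) := by
  let e := Fintype.equivFin ι
  -- Order indices by weight, breaking ties by an arbitrary enumeration.
  let g : ι → ℕ ×ₗ Fin (Fintype.card ι) := fun i => toLex (w i, e i)
  have hg : Function.Injective g := fun i k hik => by
    have := congrArg (fun p => (ofLex p).2) hik
    exact e.injective this
  let _ : LinearOrder ι := LinearOrder.lift' g hg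
  have htri : M.IsUpperTriangular := by
    intro i k hik
    by_contra hne
    have hlt : g k < g i := hik
    have hw := h i k hne (by rintro rfl; exact lt_irrefl _ hlt)
    rw [Prod.Lex.toLex_lt_toLex] at hlt
    simp only at hlt
    omega
  convert charpoly_of_isUpperTriangular M htri

noncomputable instance fintypeOrderEmbeddingFin (j : ℕ) : Fintype (Fin j ↪o Fin n) :=
  Fintype.ofEquiv _ (Set.powersetCard.ofFinEmbEquiv (n := j) (I := Fin n)).symm

/-- The `j`-th compound matrix, formed by the minors of order `j`. -/
def compound (j : ℕ) (M : Matrix (Fin n) (Fin n) R) :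
    Matrix (Fin j ↪o Fin n) (Fin j ↪o Fin n) R :=
  of fun s t => (M.submatrix s t).det

theorem compound_apply (j : ℕ) (M : Matrix (Fin n) (Fin n) R) (s t : Fin j ↪o Fin n) :
    compound j M s t = (M.submatrix s t).det := rfl

theorem compound_map (j : ℕ) (M : Matrix (Fin n) (Fin n) R) {S : Type*} [CommRing S]
    (φ : R →+* S) : (compound j M).map φ = compound j (M.map φ) := by
  ext s t
  rw [map_apply, compound_apply, compound_apply, RingHom.map_det]
  rfl

theorem charpoly_compound_of_isUpperTriangular [DecidableEq (Fin j ↪o Fin n)]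
    {M : Matrix (Fin n) (Fin n) R} (hM : M.IsUpperTriangular) :
    (compound j M).charpoly =
      ∏ s : Fin j ↪o Fin n, (Polynomial.X - Polynomial.C (∏ i, M (s i) (s i))) := by
  rw [charpoly_of_weight_lt (fun s => ∑ i, (s i : ℕ))]
  · refine Finset.prod_congr rfl fun s _ => ?_
    rw [compound_apply, det_of_isUpperTriangular]
    · rfl
    · exact fun i k hik => hM (s.lt_iff_lt.2 hik)
  · intro s t hne hst
    rw [compound_apply, det_apply] at hne
    -- A nonzero minor has a nonzero term in its expansion; triangularity then gives $s(\sigma i)\le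
    -- t(i)$ for all $i$, so the index sum grows unless the two index sets coincide.
    obtain ⟨σ, -, hσ⟩ := Finset.exists_ne_zero_of_sum_ne_zero hne
    have hle : ∀ i, s (σ i) ≤ t i := fun i => by
      by_contra! hlt
      refine hσ ?_
      rw [Finset.prod_eq_zero (Finset.mem_univ i) (by exact hM hlt), smul_zero]
    rw [← Equiv.sum_comp σ fun i => ((s i : Fin n) : ℕ)]
    refine Finset.sum_lt_sum (fun i _ => hle i) ?_
    by_contra! hge
    have heq : ∀ i, s (σ i) = t i := fun i => le_antisymm (hle i) (hge i (Finset.mem_univ i))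
    apply hst
    apply Set.powersetCard.ofFinEmbEquiv.injective
    ext x
    change x ∈ Set.powersetCard.ofFinEmbEquiv s ↔ x ∈ Set.powersetCard.ofFinEmbEquiv t
    rw [Set.powersetCard.mem_ofFinEmbEquiv_iff_mem_range,
      Set.powersetCard.mem_ofFinEmbEquiv_iff_mem_range, ← funext (f := fun i => s (σ i)) heq]
    exact (EquivLike.range_comp s σ).symm ▸ Iff.rfl

theorem charpoly_map_exteriorPower {M : Type*} [AddCommGroup M] [Module R M]
    [Module.Free R M] [Module.Finite R M] [DecidableEq (Fin j ↪o Fin n)]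
    (b : Module.Basis (Fin n) R M) (f : M →ₗ[R] M) :
    (exteriorPower.map j f).charpoly = (compound j (LinearMap.toMatrix b b f)).charpoly := by
  let B := (b.exteriorPower j).reindex Set.powersetCard.ofFinEmbEquiv.symm
  rw [← LinearMap.charpoly_toMatrix _ B]
  congr 1
  ext s t
  rw [LinearMap.toMatrix_apply, compound_apply, ← det_transpose]
  simp only [B, Module.Basis.reindex_apply, Module.Basis.repr_reindex_apply, Equiv.symm_symm,
    exteriorPower.basis_apply, exteriorPower.basis_repr_apply, exteriorPower.ιMulti_family,
    Equiv.symm_apply_apply, exteriorPower.map_apply_ιMulti]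
  rw [exteriorPower.ιMultiDual_apply_ιMulti, Equiv.symm_apply_apply]
  congr 1
  ext i k
  simp [LinearMap.toMatrix_apply]

end Matrix

/-! ### Eigenvalues of exterior powers -/

section ExteriorPower

variable {V : Type*} [AddCommGroup V] [Module ℝ V] [FiniteDimensional ℝ V] {n : ℕ}

theorem complexEigenvalues_eq_of_isUpperTriangular {T : V →ₗ[ℝ] V}
    {b : Module.Basis (Fin n) ℂ (ℂ ⊗[ℝ] V)}
    (hb : (LinearMap.toMatrix b b (T.baseChange ℂ)).IsUpperTriangular) :
    complexEigenvalues T =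
      Finset.univ.val.map fun i => LinearMap.toMatrix b b (T.baseChange ℂ) i i := by
  rw [complexEigenvalues_eq, ← LinearMap.charpoly_toMatrix _ b,
    Matrix.charpoly_of_isUpperTriangular _ hb,
    ← Polynomial.roots_multiset_prod_X_sub_C (Multiset.map _ _), Multiset.map_map]
  rfl

/-- The eigenvalues of the `j`-th exterior power are the products of `j` eigenvalues. -/
theorem complexEigenvalues_exteriorPower_map (b₀ : Module.Basis (Fin n) ℝ V) {T : V →ₗ[ℝ] V}
    {b : Module.Basis (Fin n) ℂ (ℂ ⊗[ℝ] V)}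
    (hb : (LinearMap.toMatrix b b (T.baseChange ℂ)).IsUpperTriangular) (j : ℕ) :
    complexEigenvalues (exteriorPower.map j T) =
      (Finset.univ : Finset (Fin j ↪o Fin n)).val.map fun s =>
        ∏ i, LinearMap.toMatrix b b (T.baseChange ℂ) (s i) (s i) := by
  classical
  -- Both sides come from the compound of one real matrix, so no identification of $\wedge^j$ with
  -- its complexification is needed.
  have h : (exteriorPower.map j T).charpoly.map (algebraMap ℝ ℂ)
      = (exteriorPower.map j (T.baseChange ℂ)).charpoly := by
    rw [Matrix.charpoly_map_exteriorPower b₀,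
      Matrix.charpoly_map_exteriorPower (Algebra.TensorProduct.basis ℂ b₀),
      LinearMap.toMatrix_baseChange, ← Matrix.charpoly_map, Matrix.compound_map]
  rw [complexEigenvalues, h, Matrix.charpoly_map_exteriorPower b,
    Matrix.charpoly_compound_of_isUpperTriangular hb,
    ← Polynomial.roots_multiset_prod_X_sub_C (Multiset.map _ _), Multiset.map_map]
  rfl

theorem complexEigenvalues_exteriorPower_map_one (T : V →ₗ[ℝ] V) :
    complexEigenvalues (exteriorPower.map 1 T) = complexEigenvalues T := by
  have h : (exteriorPower.oneEquiv ℝ V).conj (exteriorPower.map 1 T) = T := by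
    rw [LinearEquiv.conj_apply, exteriorPower.oneEquiv_naturality]
    ext x
    simp
  rw [complexEigenvalues, complexEigenvalues,
    ← LinearEquiv.charpoly_conj (exteriorPower.oneEquiv ℝ V), h]

end ExteriorPower

/-! ### Products over increasing index sets -/

section Products

variable {n : ℕ} {l : Fin n → ℂ}

theorem norm_prod_orderEmbedding_le (hl : Antitone fun i => ‖l i‖) {j : ℕ} (hj : j ≤ n)
    (s : Fin j ↪o Fin n) : ‖∏ i, l (s i)‖ ≤ ‖∏ i, l (Fin.castLE hj i)‖ := by
  rw [norm_prod, norm_prod]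
  refine Finset.prod_le_prod (fun _ _ => norm_nonneg _) fun i _ => hl ?_
  obtain ⟨i, hi⟩ := i
  rw [Fin.le_def]
  change i ≤ (s ⟨i, hi⟩ : ℕ)
  -- A strictly increasing sequence of naturals satisfies $s(i)\ge i$.
  induction i with
  | zero => exact Nat.zero_le _
  | succ i ih =>
    have h1 : i ≤ (s ⟨i, by omega⟩ : ℕ) := ih (by omega) (Finset.mem_univ _)
    have h2 : s ⟨i, by omega⟩ < s ⟨i + 1, hi⟩ := s.lt_iff_lt.2 (by simp)
    rw [Fin.lt_def] at h2
    omega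

/-- If `l i = l k` for some `i < k`, then two different index sets of size `i + 1` give the same
product of values of `l`. -/
theorem one_lt_count_prod {i k : Fin n} (hik : i < k) (h : l i = l k) :
    1 < ((Finset.univ : Finset (Fin (i + 1) ↪o Fin n)).val.map fun s => ∏ x, l (s x)).count
      (∏ x, l (Fin.castLE i.isLt x)) := by
  classical
  -- The second index set is $\{0,\dots,i-1,k\}$, next to $\{0,\dots,i\}$.
  have hmono : StrictMono
      (Fin.snoc (fun x : Fin i => Fin.castLE i.isLt.le x) k : Fin (i + 1) → Fin n) := by
    intro x y hxy
    induction x using Fin.lastCases with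
    | last => exact absurd hxy (Fin.le_last y).not_gt
    | cast x =>
      induction y using Fin.lastCases with
      | last =>
        simp only [Fin.snoc_castSucc, Fin.snoc_last]
        refine lt_trans ?_ hik
        rw [Fin.lt_def]
        exact x.isLt
      | cast y =>
        simp only [Fin.snoc_castSucc]
        exact hxy
  rw [Multiset.count_map]
  change 1 < (Finset.univ.filter fun s : Fin (i + 1) ↪o Fin n =>
    ∏ x, l (Fin.castLE i.isLt x) = ∏ x, l (s x)).card
  rw [Finset.one_lt_card]
  refine ⟨Fin.castLEOrderEmb i.isLt, by simp, OrderEmbedding.ofStrictMono _ hmono, ?_, ?_⟩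
  · rw [Finset.mem_filter_univ]
    simp only [OrderEmbedding.coe_ofStrictMono, Fin.prod_univ_castSucc, Fin.snoc_castSucc,
      Fin.snoc_last, ← h]
    rfl
  · intro heq
    have := DFunLike.congr_fun heq (Fin.last _)
    simp only [OrderEmbedding.coe_ofStrictMono, Fin.snoc_last] at this
    exact hik.ne this

end Products

/-! ### Spectrum of generalized oscillatory operators -/

theorem IsGeneralizedOscillatory.exists_isDominantEigenvalue {n : ℕ}
    {A : EuclideanSpace ℝ (Fin n) →ₗ[ℝ] EuclideanSpace ℝ (Fin n)}
    (hA : IsGeneralizedOscillatory A) {j : ℕ} (hj : 1 ≤ j) (hjn : j ≤ n) :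
    ∃ r, IsDominantEigenvalue (exteriorPower.map j A) r := by
  obtain ⟨⟨K, hK, hAK⟩, hA⟩ := hA
  rcases hj.eq_or_lt with rfl | hj
  · obtain ⟨r, hr, h1, h2⟩ := hAK.exists_isDominantEigenvalue hK
    rw [← complexEigenvalues_exteriorPower_map_one] at h1 h2
    exact ⟨r, hr, h1, h2⟩
  · obtain ⟨K, hK, hAK⟩ := hA j hj hjn
    exact hAK.exists_isDominantEigenvalue hK

theorem theorem3 (n : ℕ) (hn : 0 < n)
    (A : EuclideanSpace ℝ (Fin n) →ₗ[ℝ] EuclideanSpace ℝ (Fin n))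
    (hA : IsGeneralizedOscillatory A) :
    ∃ ev : Fin n → ℝ,
      complexEigenvalues A = (Finset.univ : Finset (Fin n)).val.map (fun i => (ev i : ℂ)) ∧
      (∀ z ∈ complexEigenvalues A, (complexEigenvalues A).count z = 1) ∧
      realSpectralRadius A = ev ⟨0, hn⟩ ∧
      StrictAnti ev ∧
      (∀ i, 0 < ev i) ∧
      ∀ i : Fin n, ev i =
        realSpectralRadius (exteriorPower.map ((i : ℕ) + 1) A) /
          realSpectralRadius (exteriorPower.map (i : ℕ) A) := by
  obtain ⟨b, htri, hanti⟩ := exists_basis_isUpperTriangular_antitone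
    (show Module.finrank ℂ (ℂ ⊗[ℝ] EuclideanSpace ℝ (Fin n)) = n by simp) (A.baseChange ℂ)
  have hevA := complexEigenvalues_eq_of_isUpperTriangular htri
  have hevj := complexEigenvalues_exteriorPower_map
    (EuclideanSpace.basisFun (Fin n) ℝ).toBasis htri
  set l : Fin n → ℂ := fun i => LinearMap.toMatrix b b (A.baseChange ℂ) i i with hl
  change ∀ j, _ = Multiset.map (fun s : Fin j ↪o Fin n => ∏ i, l (s i)) _ at hevj
  have hmem : ∀ {j : ℕ} (hj : j ≤ n),
      ∏ i, l (Fin.castLE hj i) ∈ complexEigenvalues (exteriorPower.map j A) := fun hj => by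
    rw [hevj]
    exact Multiset.mem_map.2 ⟨Fin.castLEOrderEmb hj, Finset.mem_univ _, rfl⟩
  have hdom : ∀ {j : ℕ}, 1 ≤ j → j ≤ n → IsDominantEigenvalue (exteriorPower.map j A)
      (realSpectralRadius (exteriorPower.map j A)) := fun h1 h2 => by
    obtain ⟨r, hr⟩ := hA.exists_isDominantEigenvalue h1 h2
    rwa [hr.realSpectralRadius_eq]
  have hprod : ∀ {j : ℕ} (hj : j ≤ n), 0 < realSpectralRadius (exteriorPower.map j A) ∧
      ∏ i, l (Fin.castLE hj i) = realSpectralRadius (exteriorPower.map j A) := fun {j} hj => by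
    -- The hypotheses say nothing about $j=0$; there the only product is the empty one.
    rcases Nat.eq_zero_or_pos j with rfl | hj1
    · have h1 : realSpectralRadius (exteriorPower.map 0 A) = 1 := by
        refine realSpectralRadius_eq zero_le_one (by simpa using hmem hj) fun z hz => ?_
        rw [hevj] at hz
        obtain ⟨s, -, rfl⟩ := Multiset.mem_map.1 hz
        simp
      simp [h1]
    · have hd := hdom hj1 hj
      refine ⟨hd.pos, ?_⟩
      -- Otherwise the leading product has modulus below $\rho(\wedge^jA)$, which is itself a
      -- $j$-fold product and so cannot exceed it in modulus.
      by_contra hne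
      have hlt := hd.norm_lt _ (hmem hj) hne
      have hr := hd.mem
      rw [hevj] at hr
      obtain ⟨s, -, hs⟩ := Multiset.mem_map.1 hr
      have hle := norm_prod_orderEmbedding_le hanti hj s
      have hs' : ∏ i, l (s i) = _ := hs
      change ‖∏ i, l (s i)‖ ≤ ‖∏ i, l (Fin.castLE hj i)‖ at hle
      rw [hs', Complex.norm_real, Real.norm_of_nonneg hd.pos.le] at hle
      exact hle.not_gt hlt
  let ev : Fin n → ℝ := fun i => realSpectralRadius (exteriorPower.map ((i : ℕ) + 1) A) /
    realSpectralRadius (exteriorPower.map (i : ℕ) A)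
  have hpos : ∀ i, 0 < ev i := fun i => div_pos (hprod i.isLt).1 (hprod i.isLt.le).1
  -- With indices starting at 0, `l i` is the quotient of the leading products of lengths $i+1$ and
  -- $i$.
  have hlev : ∀ i, l i = ev i := fun i => by
    have h1 := (hprod (j := i + 1) i.isLt).2
    have h0 := (hprod (j := i) i.isLt.le)
    have hne : (realSpectralRadius (exteriorPower.map (i : ℕ) A) : ℂ) ≠ 0 := by
      exact_mod_cast h0.1.ne'
    rw [Fin.prod_univ_castSucc] at h1
    change (∏ x : Fin i, l (Fin.castLE i.isLt.le x)) * l i = _ at h1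
    rw [h0.2] at h1
    simp only [ev]
    push_cast
    rw [eq_div_iff hne, mul_comm, h1]
  have hev : Antitone ev := fun i k hik => by
    have := hanti hik
    change ‖l k‖ ≤ ‖l i‖ at this
    rwa [hlev, hlev, Complex.norm_real, Complex.norm_real, Real.norm_of_nonneg (hpos _).le,
      Real.norm_of_nonneg (hpos _).le] at this
  have hstrict : StrictAnti ev := fun i k hik => by
    refine lt_of_le_of_ne (hev hik.le) fun heq => ?_
    have hcount := one_lt_count_prod (l := l) hik (by rw [hlev, hlev, heq])
    rw [← hevj, (hprod i.isLt).2, (hdom (Nat.le_add_left _ _) i.isLt).count_eq_one] at hcount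
    exact lt_irrefl _ hcount
  have heq : complexEigenvalues A = Finset.univ.val.map fun i => (ev i : ℂ) := by
    rw [hevA]
    exact Multiset.map_congr rfl fun i _ => hlev i
  refine ⟨ev, heq, fun z hz => ?_, ?_, hstrict, hpos, fun i => rfl⟩
  · refine Multiset.count_eq_one_of_mem ?_ hz
    rw [heq]
    exact Finset.univ.nodup.map (Complex.ofReal_injective.comp hstrict.injective)
  · refine realSpectralRadius_eq (hpos _).le ?_ fun z hz => ?_
    · rw [heq]
      exact Multiset.mem_map.2 ⟨_, Finset.mem_univ_val _, rfl⟩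
    · rw [heq] at hz
      obtain ⟨i, -, rfl⟩ := Multiset.mem_map.1 hz
      rw [Complex.norm_real, Real.norm_of_nonneg (hpos i).le]
      exact hev (Fin.le_def.2 (Nat.zero_le _))
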